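/- Call a linearly ordered set $X$ an $\eta_\alpha$-set ($\alpha$ an ordinal) if for all subsets $A,B\subseteq X$, possibly empty, with $|A|<\aleph_\alpha$, $|B|<\aleph_\alpha$ and $a<b$ for all $a\in A$, $b\in B$, there is $x\in X$ with $a<x$ for all $a\in A$ and $x<b$ for all $b\in B$. A real closed $\eta_\alpha$-field is a real closed ordered field whose underlying ordered set is an $\eta_\alpha$-set. Theorem. Let $\alpha>0$ be any ordinal and let $\mathfrak{F}$ be a real closed $\eta_\alpha$-field of cardinality $\aleph_\alpha$. Then $\mathfrak{F}$ contains a proper copy of itself, that is, there is a subfield $K\subsetneq\mathfrak{F}$ which, with the order induced from $\mathfrak{F}$, is isomorphic to $\mathfrak{F}$ as an ordered field. -/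

import Mathlib

open scoped Cardinal

universe u

/-- A linearly ordered set `X` is an `η_α`-set if for any subsets `A < B` of `X`, each of
cardinality less than `ℵ_α` (either of them may be empty), there is an element of `X` lying
strictly between `A` and `B`. -/
def IsEtaSet (α : Ordinal.{u}) (X : Type u) [LinearOrder X] : Prop :=
  ∀ A B : Set X, #A < ℵ_ α → #B < ℵ_ α → (∀ a ∈ A, ∀ b ∈ B, a < b) →
    ∃ x : X, (∀ a ∈ A, a < x) ∧ (∀ b ∈ B, x < b)

/-- A real closed `η_α`-field: an ordered field that is real closed and whose underlying ordered
set is an `η_α`-set. -/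
structure IsRealClosedEtaField (α : Ordinal.{u}) (F : Type u) [Field F] [LinearOrder F]
    [IsStrictOrderedRing F] : Prop where
  isRealClosed : IsRealClosed F
  isEtaSet : IsEtaSet α F

open Polynomial

/-! It suffices to find an order-preserving ring embedding of `F` into itself with bounded image: a
bound lies outside the image, so the image is a proper copy. An ultrapower `E` of `F` along an
ultrafilter refining `atTop` is real closed and contains an element `t` above the diagonal copy of
`F`. Embedding that copy together with `t` into `F`, with signs preserved, makes the image of `t`
the required bound.

The embedding is built by transfinite recursion of length `ω_α`, going "forth" only. A stage is a
subring of `E × F` of size below `ℵ_α` whose two coordinates always have the same sign, that is, a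
partial isomorphism. `IsEtaSet.exists_isSignCompatible_closure_insert` adjoins one more element: a
maximal sign-compatible extension is a field, relatively algebraically closed on both sides
(`SignCompatible.exists_of_eval_map_eq_zero`), so a new element is governed by the cut it makes in
the roots of polynomials, and the `η_α` property realizes that cut. Since `α > 0`, generated
subrings and the relevant algebraic elements stay fewer than `ℵ_α`.

The algebra of real closed fields enters through the intermediate value property and Rolle's theorem
for polynomials, both derived from the fact that irreducible polynomials have degree at most two. -/

/-! ### Irreducible polynomials over a real closed field, by Galois theory -/

theorem IsRealClosed.finrank_eq_one_of_odd {R E : Type*} [Field R] [IsRealClosed R] [CharZero R]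
    [Field E] [Algebra R E] [FiniteDimensional R E] (h : Odd (Module.finrank R E)) :
    Module.finrank R E = 1 := by
  obtain ⟨a, ha⟩ := Field.exists_primitive_element R E
  have hint : IsIntegral R a := Algebra.IsIntegral.isIntegral a
  have hdeg : (minpoly R a).natDegree = Module.finrank R E := by
    rw [← IntermediateField.adjoin.finrank hint, ha, IntermediateField.finrank_top']
  obtain ⟨x, hx⟩ := IsRealClosed.exists_isRoot_of_odd_natDegree (hdeg ▸ h)
  rw [← hdeg]
  exact natDegree_eq_of_degree_eq_some (degree_eq_one_of_irreducible_of_root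
    (minpoly.irreducible hint) hx)

theorem IsRealClosed.isSquare_add_mul_of_sq_eq_neg_one {R L : Type*} [Field R] [LinearOrder R]
    [IsStrictOrderedRing R] [IsRealClosed R] [CommRing L] [Algebra R L] {i : L} (hi : i ^ 2 = -1)
    (x y : R) : ∃ s t : R, (algebraMap R L s + algebraMap R L t * i) ^ 2 =
      algebraMap R L x + algebraMap R L y * i := by
  suffices ∃ s t : R, s ^ 2 - t ^ 2 = x ∧ 2 * s * t = y by
    obtain ⟨s, t, rfl, rfl⟩ := this
    refine ⟨s, t, ?_⟩
    simp only [map_sub, map_mul, map_pow, map_ofNat]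
    linear_combination (algebraMap R L t) ^ 2 * hi
  -- Here `r` is the modulus of `x + y i`; the half-sums `(r ± x) / 2` are the squares of the real
  -- and imaginary parts of the root, up to sign.
  obtain ⟨r', hr'⟩ := IsSquare.of_nonneg (R := R) (x := x ^ 2 + y ^ 2) (by positivity)
  obtain ⟨r, hr0, hr⟩ : ∃ r : R, 0 ≤ r ∧ r ^ 2 = x ^ 2 + y ^ 2 :=
    ⟨|r'|, abs_nonneg _, by rw [sq_abs, hr', sq]⟩
  have hxr : |x| ≤ r := abs_le_of_sq_le_sq' (by nlinarith [sq_nonneg y]) hr0 |> abs_le.2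
  obtain ⟨h1, h2⟩ := abs_le.1 hxr
  obtain ⟨s, hs⟩ := IsSquare.of_nonneg (R := R) (x := (r + x) / 2) (by linarith)
  obtain ⟨t, ht⟩ := IsSquare.of_nonneg (R := R) (x := (r - x) / 2) (by linarith)
  have h : (2 * s * t) ^ 2 = y ^ 2 := by
    have : (2 * s * t) ^ 2 = 4 * (s * s) * (t * t) := by ring
    rw [this, ← hs, ← ht]
    linear_combination hr
  rcases sq_eq_sq_iff_eq_or_eq_neg.1 h with h | h
  · exact ⟨s, t, by linear_combination -hs + ht, h⟩
  · exact ⟨s, -t, by linear_combination -hs + ht, by linear_combination -h⟩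

theorem finrank_ne_two_of_forall_isSquare {K M : Type*} [Field K] [CharZero K]
    (hK : ∀ x : K, IsSquare x) [Field M] [Algebra K M] : Module.finrank K M ≠ 2 := by
  intro h
  have : FiniteDimensional K M := Module.finite_of_finrank_pos (by lia)
  obtain ⟨a, ha⟩ := Field.exists_primitive_element K M
  have hint : IsIntegral K a := Algebra.IsIntegral.isIntegral a
  have hdeg : (minpoly K a).natDegree = 2 := by
    rw [← IntermediateField.adjoin.finrank hint, ha, IntermediateField.finrank_top', h]
  have hirr := minpoly.irreducible hint
  obtain ⟨s, hs⟩ := hK (discrim ((minpoly K a).coeff 2) ((minpoly K a).coeff 1)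
    ((minpoly K a).coeff 0))
  have hroot : ∃ x, (minpoly K a).IsRoot x := by
    have h2 : (minpoly K a).coeff 2 ≠ 0 := by
      rw [← hdeg]; simpa using hirr.ne_zero
    obtain ⟨x, hx⟩ := exists_quadratic_eq_zero h2 ⟨s, hs⟩
    refine ⟨x, ?_⟩
    rw [IsRoot, eval_eq_sum_range, hdeg]
    simp only [Finset.sum_range_succ, Finset.sum_range_zero]
    linear_combination hx
  obtain ⟨x, hx⟩ := hroot
  have : (minpoly K a).natDegree = 1 :=
    natDegree_eq_of_degree_eq_some (degree_eq_one_of_irreducible_of_root hirr hx)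
  lia

/-- The fixed field of a Sylow 2-subgroup has odd degree over `R`, hence is `R`, so the degree of
`L` is a power of 2. If `L` were larger than `K = R(i)`, a subgroup of index 2 in `Gal(L/K)` would
give a quadratic extension of `K`, yet every element of `K` is a square. -/
theorem IsRealClosed.finrank_le_two_of_isGalois {R L : Type*} [Field R] [LinearOrder R]
    [IsStrictOrderedRing R] [IsRealClosed R] [Field L] [Algebra R L] [FiniteDimensional R L]
    [IsGalois R L] {i : L} (hi : i ^ 2 = -1) : Module.finrank R L ≤ 2 := by
  have hX : (X ^ 2 + 1 : R[X]).Monic := by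
    rw [← C_1]; exact monic_X_pow_add_C 1 two_ne_zero
  have : CharZero L := charZero_of_injective_algebraMap (algebraMap R L).injective
  obtain ⟨P⟩ : Nonempty (Sylow 2 Gal(L/R)) := inferInstance
  have hP : Odd (Module.finrank R (IntermediateField.fixedField P.toSubgroup)) := by
    have h1 := IntermediateField.finrank_fixedField_eq_card P.toSubgroup
    have h2 := Module.finrank_mul_finrank R (IntermediateField.fixedField P.toSubgroup) L
    have h3 := P.toSubgroup.card_mul_index
    rw [h1, ← IsGalois.card_aut_eq_finrank R L, ← h3, mul_comm] at h2
    have h4 := Nat.eq_of_mul_eq_mul_left Nat.card_pos h2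
    rw [h4, ← Nat.not_even_iff_odd, even_iff_two_dvd]
    exact P.not_dvd_index
  have hRL : ∃ k, Module.finrank R L = 2 ^ k := by
    have h2 := Module.finrank_mul_finrank R (IntermediateField.fixedField P.toSubgroup) L
    rw [IsRealClosed.finrank_eq_one_of_odd hP, one_mul,
      IntermediateField.finrank_fixedField_eq_card] at h2
    obtain ⟨k, hk⟩ := (IsPGroup.iff_card (p := 2)).1 P.isPGroup'
    exact ⟨k, by rw [← h2, ← hk]⟩
  obtain ⟨k, hk⟩ := hRL
  let K := IntermediateField.adjoin R {i}
  have hint : IsIntegral R i := Algebra.IsIntegral.isIntegral i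
  have hRK : Module.finrank R K ≤ 2 := by
    rw [IntermediateField.adjoin.finrank hint]
    have : natDegree (X ^ 2 + 1 : R[X]) = 2 := by rw [← C_1, natDegree_X_pow_add_C]
    rw [← this]
    exact natDegree_le_of_dvd (minpoly.dvd _ _ (by simp [hi])) hX.ne_zero
  have hKsq : ∀ x : K, IsSquare x := by
    rintro ⟨x, hx⟩
    have hx' : x ∈ Algebra.adjoin R {i} := by
      rwa [← IntermediateField.adjoin_simple_toSubalgebra_of_isAlgebraic hint.isAlgebraic]
    rw [Algebra.adjoin_singleton_eq_range_aeval] at hx'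
    obtain ⟨p, hp⟩ := hx'
    have hmod : aeval i (p %ₘ (X ^ 2 + 1)) = x := by
      rw [← hp]
      exact aeval_modByMonic_eq_self_of_root (by simp [hi])
    have hdeg : (p %ₘ (X ^ 2 + 1)).natDegree ≤ 1 := by
      have := natDegree_modByMonic_lt p hX (by
        intro h; have := congrArg (eval 0) h; have h' := congrArg (eval 1) h; simp at this h'
        )
      have h' : natDegree (X ^ 2 + 1 : R[X]) = 2 := by rw [← C_1, natDegree_X_pow_add_C]
      lia
    obtain ⟨y, z, hyz⟩ := exists_eq_X_add_C_of_natDegree_le_one hdeg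
    rw [hyz] at hmod
    obtain ⟨s, t, hst⟩ := IsRealClosed.isSquare_add_mul_of_sq_eq_neg_one (L := L) hi z y
    have hiK : i ∈ K := IntermediateField.mem_adjoin_simple_self R i
    refine ⟨⟨algebraMap R L s + algebraMap R L t * i, add_mem (K.algebraMap_mem s)
      (mul_mem (K.algebraMap_mem t) hiK)⟩, Subtype.ext ?_⟩
    simp only [MulMemClass.mk_mul_mk]
    rw [← sq, hst, ← hmod]
    rw [map_add, map_mul, aeval_C, aeval_C, aeval_X, add_comm]
  have hKL : Module.finrank K L = 1 := by
    obtain ⟨m, -, hm⟩ := (Nat.dvd_prime_pow Nat.prime_two).1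
      (hk ▸ Dvd.intro_left _ (Module.finrank_mul_finrank R K L))
    rcases m with _ | m
    · simpa using hm
    exfalso
    obtain ⟨H, hH⟩ := Sylow.exists_subgroup_card_pow_prime (G := Gal(L/K)) 2 (n := m)
      (by rw [IsGalois.card_aut_eq_finrank, hm]; exact pow_dvd_pow _ (by lia))
    have h1 := IntermediateField.finrank_fixedField_eq_card H
    have h2 := Module.finrank_mul_finrank K (IntermediateField.fixedField H) L
    rw [h1, hm, hH, pow_succ'] at h2
    exact finrank_ne_two_of_forall_isSquare hKsq (Nat.eq_of_mul_eq_mul_right (by positivity) h2)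
  rw [← Module.finrank_mul_finrank R K L, hKL, mul_one]
  exact hRK

theorem IsRealClosed.natDegree_le_two_of_irreducible {R : Type*} [Field R] [LinearOrder R]
    [IsStrictOrderedRing R] [IsRealClosed R] {f : R[X]} (hf : Irreducible f) :
    f.natDegree ≤ 2 := by
  -- The extra factor puts a square root of `-1` into the splitting field.
  set q : R[X] := f * (X ^ 2 + 1) with hq
  have hX : (X ^ 2 + 1 : R[X]).Monic := by
    rw [← C_1]; exact monic_X_pow_add_C 1 two_ne_zero
  have hq0 : q ≠ 0 := mul_ne_zero hf.ne_zero hX.ne_zero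
  let L := q.SplittingField
  have : Normal R L := Normal.of_isSplittingField q
  have : IsGalois R L := ⟨⟩
  have hsplit := SplittingField.splits q
  rw [hq, Polynomial.map_mul] at hsplit
  have hne : (f.map (algebraMap R L)) * ((X ^ 2 + 1 : R[X]).map (algebraMap R L)) ≠ 0 := by
    rw [← Polynomial.map_mul]; exact (Polynomial.map_ne_zero_iff (algebraMap R L).injective).2 hq0
  obtain ⟨a, ha⟩ := (hsplit.of_dvd hne (dvd_mul_right _ _)).exists_eval_eq_zero
    (by rw [degree_map]; exact (degree_pos_of_irreducible hf).ne')
  obtain ⟨i, hi⟩ := (hsplit.of_dvd hne (dvd_mul_left _ _)).exists_eval_eq_zero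
    (by rw [degree_map, ← C_1, degree_X_pow_add_C two_pos]; simp)
  replace hi : i ^ 2 = -1 := by
    simp at hi
    linear_combination hi
  have hRL2 : Module.finrank R L ≤ 2 := IsRealClosed.finrank_le_two_of_isGalois hi
  have h1 : (minpoly R a).natDegree ≤ 2 := (minpoly.natDegree_le a).trans hRL2
  refine le_trans (natDegree_le_of_dvd ?_ (minpoly.ne_zero (Algebra.IsIntegral.isIntegral a))) h1
  have ha' : aeval a f = 0 := by rwa [aeval_def, eval₂_eq_eval_map]
  exact ((minpoly.irreducible (Algebra.IsIntegral.isIntegral a)).associated_of_dvd hf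
    (minpoly.dvd _ _ ha')).symm.dvd

/-! ### Intermediate values, Rolle's theorem and root bounds for polynomials -/

namespace IsRealClosed

variable {R : Type*} [Field R] [LinearOrder R] [IsStrictOrderedRing R] [IsRealClosed R]

theorem eval_mul_eval_pos_of_irreducible {q : R[X]} (hq : Irreducible q) {a b : R} (hab : a ≤ b)
    (h : ∀ c ∈ Set.Icc a b, q.eval c ≠ 0) : 0 < q.eval a * q.eval b := by
  have hd := natDegree_le_two_of_irreducible hq
  by_cases hroot : ∃ x, q.IsRoot x
  · obtain ⟨x, hx⟩ := hroot
    have h1 := degree_eq_one_of_irreducible_of_root hq hx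
    have h2 : q.coeff 1 ≠ 0 := coeff_ne_zero_of_eq_degree h1
    have key : ∀ y, q.eval y = q.coeff 1 * (y - x) := by
      intro y
      have hx' : q.eval x = 0 := hx
      rw [eq_X_add_C_of_degree_le_one h1.le] at hx' ⊢
      simp only [eval_add, eval_mul, eval_C, eval_X] at hx' ⊢
      simp
      linear_combination hx'
    have hxab : x < a ∨ b < x := by
      by_contra! hc
      exact h x hc hx
    rw [key, key]
    have : q.coeff 1 * (a - x) * (q.coeff 1 * (b - x)) = q.coeff 1 ^ 2 * ((a - x) * (b - x)) := by
      ring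
    rw [this]
    apply mul_pos (by positivity)
    rcases hxab with hx | hx
    · exact mul_pos (by linarith) (by linarith)
    · exact mul_pos_of_neg_of_neg (by linarith) (by linarith)
  · have ev : ∀ y, q.eval y = q.coeff 2 * (y * y) + q.coeff 1 * y + q.coeff 0 := by
      intro y
      rw [eval_eq_sum_range' (n := 3) (by lia)]
      simp only [Finset.sum_range_succ, Finset.sum_range_zero]
      ring
    by_cases h2 : q.coeff 2 = 0
    · exfalso
      have hd1 : q.natDegree = 1 := by
        have h0 := hq.natDegree_pos
        by_contra h1
        have h3 : q.natDegree = 2 := by lia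
        rw [← h3] at h2
        exact hq.ne_zero (leadingCoeff_eq_zero.1 h2)
      have h1 : q.coeff 1 ≠ 0 := by
        rw [← hd1]; exact leadingCoeff_ne_zero.2 hq.ne_zero
      refine hroot ⟨-q.coeff 0 / q.coeff 1, ?_⟩
      rw [IsRoot, ev, h2]
      field_simp
      ring
    · have hD : discrim (q.coeff 2) (q.coeff 1) (q.coeff 0) < 0 := by
        by_contra! hD
        obtain ⟨s, hs⟩ := IsSquare.of_nonneg hD
        obtain ⟨x, hx⟩ := exists_quadratic_eq_zero h2 ⟨s, hs⟩
        exact hroot ⟨x, by rw [IsRoot, ev, hx]⟩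
      -- Completing the square: with negative discriminant, `q` has the sign of its leading
      -- coefficient everywhere.
      have key : ∀ y, 0 < 4 * q.coeff 2 * q.eval y := by
        intro y
        have : 4 * q.coeff 2 * q.eval y = (2 * q.coeff 2 * y + q.coeff 1) ^ 2 -
            discrim (q.coeff 2) (q.coeff 1) (q.coeff 0) := by
          rw [ev, discrim]; ring
        rw [this]
        linarith [sq_nonneg (2 * q.coeff 2 * y + q.coeff 1)]
      have := mul_pos (key a) (key b)
      have h3 : 4 * q.coeff 2 * q.eval a * (4 * q.coeff 2 * q.eval b) =
        (4 * q.coeff 2) ^ 2 * (q.eval a * q.eval b) := by ring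
      rw [h3] at this
      exact pos_of_mul_pos_right this (sq_nonneg _)

/-- A polynomial over a real closed field without zeros on an interval has constant sign there. -/
theorem eval_mul_eval_pos {p : R[X]} {a b : R} (hab : a ≤ b)
    (h : ∀ c ∈ Set.Icc a b, p.eval c ≠ 0) : 0 < p.eval a * p.eval b := by
  induction p using WfDvdMonoid.induction_on_irreducible with
  | zero => exact absurd eval_zero (h a ⟨le_rfl, hab⟩)
  | unit p hp =>
    obtain ⟨r, hr, rfl⟩ := isUnit_iff.1 hp
    simpa using mul_self_pos.2 hr.ne_zero
  | mul p q hp hq ih =>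
    have h1 := eval_mul_eval_pos_of_irreducible hq hab fun c hc h0 => h c hc (by simp [h0])
    have h2 := ih fun c hc h0 => h c hc (by simp [h0])
    rw [eval_mul, eval_mul, mul_mul_mul_comm]
    exact mul_pos h1 h2

theorem exists_isRoot_of_eval_mul_eval_neg {p : R[X]} {a b : R} (hab : a ≤ b)
    (h : p.eval a * p.eval b < 0) : ∃ c ∈ Set.Ioo a b, p.eval c = 0 := by
  by_contra! hc
  refine (eval_mul_eval_pos hab fun c hcab h0 => ?_).not_gt h
  rcases eq_or_lt_of_le hcab.1 with rfl | h1
  · simp [h0] at h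
  rcases eq_or_lt_of_le hcab.2 with rfl | h2
  · simp [h0] at h
  exact hc c ⟨h1, h2⟩ h0

/-- Factor `p = (X - a)^(m+1) (X - b)^(n+1) r` with `r` nonvanishing on `[a, b]`. Then `p' = (X -
a)^m (X - b)^n w`, and `w` has opposite signs at `a` and `b`. -/
theorem exists_eval_derivative_eq_zero_of_consecutive {p : R[X]} (hp : p ≠ 0) {a b : R}
    (hab : a < b) (ha : p.eval a = 0) (hb : p.eval b = 0)
    (h : ∀ c ∈ Set.Ioo a b, p.eval c ≠ 0) :
    ∃ c ∈ Set.Ioo a b, (derivative p).eval c = 0 := by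
  obtain ⟨q, hq, hqa⟩ := exists_eq_pow_rootMultiplicity_mul_and_not_dvd p hp a
  have hq0 : q ≠ 0 := by rintro rfl; simp at hqa
  obtain ⟨r, hr, hrb⟩ := exists_eq_pow_rootMultiplicity_mul_and_not_dvd q hq0 b
  obtain ⟨m, hm⟩ := Nat.exists_eq_succ_of_ne_zero ((rootMultiplicity_pos hp).2 ha).ne'
  have hqb : q.eval b = 0 := by
    rw [hq] at hb
    simpa [sub_ne_zero.2 hab.ne'] using hb
  obtain ⟨n, hn⟩ := Nat.exists_eq_succ_of_ne_zero ((rootMultiplicity_pos hq0).2 hqb).ne'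
  rw [hm] at hq
  rw [hn] at hr
  rw [dvd_iff_isRoot, IsRoot] at hqa hrb
  have hra : r.eval a ≠ 0 := by
    intro h0; apply hqa; rw [hr]; simp [h0]
  have hpos : 0 < r.eval a * r.eval b := eval_mul_eval_pos hab.le fun c hc h0 => by
    rcases eq_or_lt_of_le hc.1 with rfl | h1
    · exact hra h0
    rcases eq_or_lt_of_le hc.2 with rfl | h2
    · exact hrb h0
    exact h c ⟨h1, h2⟩ (by rw [hq, hr]; simp [h0])
  let w : R[X] := (C (m + 1 : R) * (X - C b) + C (n + 1 : R) * (X - C a)) * r +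
    (X - C a) * (X - C b) * derivative r
  have hw : w.eval a * w.eval b < 0 := by
    have : w.eval a * w.eval b =
        -((m + 1) * (n + 1) * ((b - a) ^ 2 * (r.eval a * r.eval b))) := by
      simp only [w, eval_add, eval_mul, eval_C, eval_X, eval_sub]; ring
    rw [this, neg_neg_iff_pos]
    have := sub_pos.2 hab
    positivity
  obtain ⟨c, hc, hc0⟩ := exists_isRoot_of_eval_mul_eval_neg hab.le hw
  refine ⟨c, hc, ?_⟩
  have : derivative p = (X - C a) ^ m * (X - C b) ^ n * w := by
    rw [hq, hr]
    simp only [derivative_mul, derivative_X_sub_C_pow, w, Nat.succ_eq_add_one, Nat.add_sub_cancel,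
      Nat.cast_add, Nat.cast_one, map_add, map_one, map_natCast]
    ring
  rw [this, eval_mul, hc0, mul_zero]

/-- Rolle's theorem for polynomials over a real closed field. -/
theorem exists_eval_derivative_eq_zero {p : R[X]} {a b : R} (hab : a < b) (ha : p.eval a = 0)
    (hb : p.eval b = 0) : ∃ c ∈ Set.Ioo a b, (derivative p).eval c = 0 := by
  rcases eq_or_ne p 0 with rfl | hp
  · obtain ⟨c, hc⟩ := exists_between hab
    exact ⟨c, hc, by simp⟩
  let s := p.roots.toFinset.filter (a < ·)
  have hmem : ∀ x, x ∈ s ↔ p.eval x = 0 ∧ a < x := by simp [s, hp]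
  have hs : s.Nonempty := ⟨b, (hmem b).2 ⟨hb, hab⟩⟩
  have hmin := (hmem _).1 (s.min'_mem hs)
  obtain ⟨c, hc, hc0⟩ := exists_eval_derivative_eq_zero_of_consecutive hp hmin.2 ha hmin.1
    fun c hc h0 => (s.min'_le c ((hmem c).2 ⟨h0, hc.1⟩)).not_gt hc.2
  exact ⟨c, ⟨hc.1, hc.2.trans_le (s.min'_le b ((hmem b).2 ⟨hb, hab⟩))⟩, hc0⟩

theorem eq_of_eval_derivative_ne_zero {p : R[X]} {l u : R}
    (h : ∀ c ∈ Set.Ioo l u, (derivative p).eval c ≠ 0) {a b : R} (ha : a ∈ Set.Icc l u)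
    (hb : b ∈ Set.Icc l u) (ha0 : p.eval a = 0) (hb0 : p.eval b = 0) : a = b := by
  by_contra hne
  rcases lt_or_gt_of_ne hne with hlt | hlt
  · obtain ⟨c, hc, hc0⟩ := exists_eval_derivative_eq_zero hlt ha0 hb0
    exact h c ⟨ha.1.trans_lt hc.1, hc.2.trans_le hb.2⟩ hc0
  · obtain ⟨c, hc, hc0⟩ := exists_eval_derivative_eq_zero hlt hb0 ha0
    exact h c ⟨hb.1.trans_lt hc.1, hc.2.trans_le ha.2⟩ hc0

/-- The root `a` is simple and, by Rolle, the only one in `[l, u]`, so the cofactor of `X - a` keeps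
its sign there. -/
theorem eval_mul_eval_neg_of_eval_derivative_ne_zero {p : R[X]} {l a u : R} (hla : l < a)
    (hau : a < u) (h : ∀ c ∈ Set.Ioo l u, (derivative p).eval c ≠ 0) (ha : p.eval a = 0) :
    p.eval l * p.eval u < 0 := by
  obtain ⟨q, rfl⟩ := dvd_iff_isRoot.2 ha
  have hq : 0 < q.eval l * q.eval u := by
    refine eval_mul_eval_pos (hla.trans hau).le fun c hc h0 => ?_
    obtain rfl : c = a := eq_of_eval_derivative_ne_zero h hc ⟨hla.le, hau.le⟩ (by simp [h0]) ha
    exact h c ⟨hla, hau⟩ (by simp [derivative_mul, h0])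
  have : ((X - C a) * q).eval l * ((X - C a) * q).eval u =
      -((a - l) * (u - a) * (q.eval l * q.eval u)) := by
    simp only [eval_mul, eval_sub, eval_X, eval_C]; ring
  rw [this, neg_neg_iff_pos]
  exact mul_pos (mul_pos (sub_pos.2 hla) (sub_pos.2 hau)) hq

end IsRealClosed

/-- Cauchy's bound: for `|a| ≥ 1` each lower term is at most its coefficient times `|a| ^ (n - 1)`.
-/
theorem abs_lt_of_eval_eq_zero {R : Type*} [Field R] [LinearOrder R] [IsStrictOrderedRing R]
    {p : R[X]} (hp : 0 < p.natDegree) {a : R} (ha : p.eval a = 0) :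
    |a| < 1 + ∑ i ∈ Finset.range p.natDegree, |p.coeff i / p.leadingCoeff| := by
  set S := ∑ i ∈ Finset.range p.natDegree, |p.coeff i / p.leadingCoeff| with hS
  by_contra! h
  have hlc : p.leadingCoeff ≠ 0 := by
    rw [Ne, leadingCoeff_eq_zero]; rintro rfl; simp at hp
  have hS0 : 0 ≤ S := Finset.sum_nonneg fun i _ => abs_nonneg _
  have h1 : 1 ≤ |a| := by linarith
  have hpow : a ^ p.natDegree =
      -∑ i ∈ Finset.range p.natDegree, p.coeff i / p.leadingCoeff * a ^ i := by
    rw [eval_eq_sum_range, Finset.sum_range_succ, coeff_natDegree] at ha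
    have : ∑ i ∈ Finset.range p.natDegree, p.coeff i / p.leadingCoeff * a ^ i =
        (∑ i ∈ Finset.range p.natDegree, p.coeff i * a ^ i) / p.leadingCoeff := by
      rw [Finset.sum_div]
      exact Finset.sum_congr rfl fun i _ => by ring
    rw [this]
    field_simp
    linear_combination ha
  have hle : |a| ^ p.natDegree ≤ S * |a| ^ (p.natDegree - 1) := by
    rw [← abs_pow, hpow, abs_neg, hS, Finset.sum_mul]
    refine (Finset.abs_sum_le_sum_abs _ _).trans (Finset.sum_le_sum fun i hi => ?_)
    rw [abs_mul, abs_pow]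
    have := Finset.mem_range.1 hi
    exact mul_le_mul_of_nonneg_left (pow_le_pow_right₀ h1 (by lia)) (abs_nonneg _)
  obtain ⟨n, hn⟩ := Nat.exists_eq_succ_of_ne_zero hp.ne'
  rw [hn, Nat.succ_sub_one, pow_succ'] at hle
  have := le_of_mul_le_mul_right hle (by positivity)
  linarith

namespace IsRealClosed

theorem eval_pos_iff_of_same_cut {R : Type*} [Field R] [LinearOrder R] [IsStrictOrderedRing R]
    [IsRealClosed R] {p : R[X]} {a z : R}
    (h : ∀ c, p.eval c = 0 → (c < a ∧ c < z) ∨ (a < c ∧ z < c)) :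
    0 < p.eval a ↔ 0 < p.eval z := by
  have key : 0 < p.eval a * p.eval z := by
    rcases le_total a z with haz | haz
    · refine eval_mul_eval_pos haz fun c hc h0 => ?_
      rcases h c h0 with h | h
      · exact h.1.not_ge hc.1
      · exact h.2.not_ge hc.2
    · rw [mul_comm]
      refine eval_mul_eval_pos haz fun c hc h0 => ?_
      rcases h c h0 with h | h
      · exact h.2.not_ge hc.1
      · exact h.1.not_ge hc.2
  exact ⟨fun h => (mul_pos_iff_of_pos_left h).1 key, fun h => (mul_pos_iff_of_pos_right h).1 key⟩

end IsRealClosed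

/-! ### Maximal sign-compatible pairs are relatively algebraically closed -/

/-- Two ring homomorphisms into ordered rings induce the same positive cone on their domain. -/
def SignCompatible {A R S : Type*} [Ring A] [Ring R] [LT R] [Ring S] [LT S]
    (f : A →+* R) (g : A →+* S) : Prop :=
  ∀ x, 0 < f x ↔ 0 < g x

namespace SignCompatible

theorem symm {A R S : Type*} [Ring A] [Ring R] [LT R] [Ring S] [LT S] {f : A →+* R}
    {g : A →+* S} (h : SignCompatible f g) : SignCompatible g f := fun x => (h x).symm

/-- No further pair of elements can be adjoined to the pair of ring homomorphisms. -/
def IsMaximal {A R S : Type*} [CommRing A] [CommRing R] [LT R] [CommRing S] [LT S]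
    (f : A →+* R) (g : A →+* S) : Prop :=
  ∀ a b, SignCompatible (eval₂RingHom f a) (eval₂RingHom g b) → ∃ k, f k = a ∧ g k = b

theorem IsMaximal.symm {A R S : Type*} [CommRing A] [CommRing R] [LT R] [CommRing S] [LT S]
    {f : A →+* R} {g : A →+* S} (hm : IsMaximal f g) : IsMaximal g f := fun a b h =>
  (hm b a h.symm).imp fun _ => And.symm

section Ring

variable {A R S : Type*} [Ring A] [Ring R] [LinearOrder R] [IsStrictOrderedRing R] [Ring S]
  [LinearOrder S] [IsStrictOrderedRing S] {f : A →+* R} {g : A →+* S}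

theorem lt_iff (h : SignCompatible f g) (x y : A) : f x < f y ↔ g x < g y := by
  rw [← sub_pos, ← map_sub, h, map_sub, sub_pos]

theorem le_iff (h : SignCompatible f g) (x y : A) : f x ≤ f y ↔ g x ≤ g y := by
  rw [← not_lt, h.lt_iff, not_lt]

theorem eq_iff (h : SignCompatible f g) (x y : A) : f x = f y ↔ g x = g y := by
  rw [le_antisymm_iff, h.le_iff, h.le_iff, ← le_antisymm_iff]

theorem neg_iff (h : SignCompatible f g) (x : A) : f x < 0 ↔ g x < 0 := by
  simpa using h.lt_iff x 0

theorem eq_zero_iff (h : SignCompatible f g) (x : A) : f x = 0 ↔ g x = 0 := by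
  simpa using h.eq_iff x 0

end Ring

section Field

variable {K R S : Type*} [Field K] [Field R] [LinearOrder R] [IsStrictOrderedRing R] [Field S]
  [LinearOrder S] [IsStrictOrderedRing S] {f : K →+* R} {g : K →+* S}

theorem exists_between_finsets (f : K →+* R) (L U : Finset K)
    (hLU : ∀ l ∈ L, ∀ u ∈ U, f l < f u) :
    ∃ z, (∀ l ∈ L, f l < f z) ∧ ∀ u ∈ U, f z < f u := by
  rcases L.eq_empty_or_nonempty with rfl | hL
  · rcases U.eq_empty_or_nonempty with rfl | hU
    · exact ⟨0, by simp, by simp⟩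
    · obtain ⟨u, hu, hmin⟩ := U.exists_min_image f hU
      refine ⟨u - 1, by simp, fun v hv => ?_⟩
      have := hmin v hv
      rw [map_sub, map_one]
      linarith
  · obtain ⟨l, hl, hmax⟩ := L.exists_max_image f hL
    rcases U.eq_empty_or_nonempty with rfl | hU
    · refine ⟨l + 1, fun v hv => ?_, by simp⟩
      have := hmax v hv
      rw [map_add, map_one]
      linarith
    · obtain ⟨u, hu, hmin⟩ := U.exists_min_image f hU
      have hlu := hLU l hl u hu
      refine ⟨(l + u) / 2, fun v hv => ?_, fun v hv => ?_⟩
      · have := hmax v hv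
        rw [map_div₀, map_add, map_ofNat]
        linarith
      · have := hmin v hv
        rw [map_div₀, map_add, map_ofNat]
        linarith

/-- Some `z` in `K` lies in the same position as `a` among the finitely many roots of `p`. No root
separates `a` from `f z` or `b` from `g z`, so both signs are read off from `p.eval z`. -/
theorem eval_map_pos_iff [IsRealClosed R] [IsRealClosed S] (h : SignCompatible f g) {p : K[X]}
    (hp : p ≠ 0) (hf : ∀ x, (p.map f).eval x = 0 → ∃ k, f k = x)
    (hg : ∀ x, (p.map g).eval x = 0 → ∃ k, g k = x) {a : R} {b : S}
    (hlt : ∀ k, p.eval k = 0 → (f k < a ↔ g k < b))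
    (hgt : ∀ k, p.eval k = 0 → (a < f k ↔ b < g k)) :
    0 < (p.map f).eval a ↔ 0 < (p.map g).eval b := by
  classical
  have hroot_f : ∀ k, (p.map f).eval (f k) = 0 ↔ p.eval k = 0 := fun k => by
    rw [eval_map_apply, map_eq_zero]
  have hroot_g : ∀ k, (p.map g).eval (g k) = 0 ↔ p.eval k = 0 := fun k => by
    rw [eval_map_apply, map_eq_zero]
  by_cases ha : ∃ k, p.eval k = 0 ∧ f k = a
  · obtain ⟨k, hk, rfl⟩ := ha
    obtain rfl : g k = b := le_antisymm (not_lt.1 fun hb => lt_irrefl _ ((hgt k hk).2 hb))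
      (not_lt.1 fun hb => lt_irrefl _ ((hlt k hk).2 hb))
    rw [(hroot_f k).2 hk, (hroot_g k).2 hk]
    simp
  have ha' : ∀ k, p.eval k = 0 → f k < a ∨ a < f k := fun k hk =>
    lt_or_gt_of_ne fun h => ha ⟨k, hk, h⟩
  have hmem : ∀ k, k ∈ p.roots.toFinset ↔ p.eval k = 0 := by simp [hp]
  obtain ⟨z, hz1, hz2⟩ := exists_between_finsets f (p.roots.toFinset.filter (f · < a))
    (p.roots.toFinset.filter (a < f ·)) fun l hl u hu =>
      (Finset.mem_filter.1 hl).2.trans (Finset.mem_filter.1 hu).2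
  simp only [Finset.mem_filter, hmem, and_imp] at hz1 hz2
  have h1 : 0 < (p.map f).eval a ↔ 0 < (p.map f).eval (f z) := by
    refine IsRealClosed.eval_pos_iff_of_same_cut fun c hc => ?_
    obtain ⟨k, rfl⟩ := hf c hc
    rw [hroot_f] at hc
    exact (ha' k hc).imp (fun h => ⟨h, hz1 k hc h⟩) fun h => ⟨h, hz2 k hc h⟩
  have h2 : 0 < (p.map g).eval b ↔ 0 < (p.map g).eval (g z) := by
    refine IsRealClosed.eval_pos_iff_of_same_cut fun c hc => ?_
    obtain ⟨k, rfl⟩ := hg c hc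
    rw [hroot_g] at hc
    exact (ha' k hc).imp (fun h' => ⟨(hlt k hc).1 h', (h.lt_iff _ _).1 (hz1 k hc h')⟩)
      fun h' => ⟨(hgt k hc).1 h', (h.lt_iff _ _).1 (hz2 k hc h')⟩
  rw [h1, h2, eval_map_apply, eval_map_apply, h]

theorem exists_abs_lt_of_eval_map_eq_zero (f : K →+* R) {p : K[X]} (hp : 0 < p.natDegree) {a : R}
    (ha : (p.map f).eval a = 0) : ∃ M, f (-M) < a ∧ a < f M := by
  -- `K` carries no order, so `1 + x ^ 2` replaces `|x|` in the Cauchy bound.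
  refine ⟨1 + ∑ i ∈ Finset.range p.natDegree, (1 + (p.coeff i / p.leadingCoeff) ^ 2), ?_⟩
  rw [map_neg, ← abs_lt]
  have := abs_lt_of_eval_eq_zero (p := p.map f) (by rwa [natDegree_map]) ha
  refine this.trans_le ?_
  rw [natDegree_map, leadingCoeff_map, map_add, map_one, map_sum]
  gcongr with i hi
  rw [coeff_map, ← map_div₀, map_add, map_one, map_pow]
  generalize f _ = x
  rw [abs_le]
  constructor <;> nlinarith [sq_nonneg (x + 1), sq_nonneg (x - 1)]

theorem exists_bracket (f : K →+* R) {p : K[X]} (hp : 0 < p.natDegree) {q : K[X]} (hq0 : q ≠ 0)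
    (hq : ∀ x, (q.map f).eval x = 0 → ∃ k, f k = x) {a : R} (ha : (p.map f).eval a = 0)
    (hak : ∀ k, f k ≠ a) :
    ∃ l u, f l < a ∧ a < f u ∧ ∀ c ∈ Set.Ioo (f l) (f u), (q.map f).eval c ≠ 0 := by
  classical
  obtain ⟨M, hM1, hM2⟩ := exists_abs_lt_of_eval_map_eq_zero f hp ha
  have hmem : ∀ k, k ∈ q.roots.toFinset ↔ q.eval k = 0 := by simp [hq0]
  obtain ⟨l, hl, hlmax⟩ := (insert (-M) (q.roots.toFinset.filter (f · < a))).exists_max_image f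
    (Finset.insert_nonempty _ _)
  obtain ⟨u, hu, humin⟩ := (insert M (q.roots.toFinset.filter (a < f ·))).exists_min_image f
    (Finset.insert_nonempty _ _)
  simp only [Finset.mem_insert, Finset.mem_filter, hmem] at hl hlmax hu humin
  refine ⟨l, u, ?_, ?_, fun c hc hc0 => ?_⟩
  · rcases hl with rfl | hl
    · exact hM1
    · exact hl.2
  · rcases hu with rfl | hu
    · exact hM2
    · exact hu.2
  · obtain ⟨k, rfl⟩ := hq c hc0
    rw [eval_map_apply, map_eq_zero] at hc0
    rcases lt_or_gt_of_ne (hak k) with h | h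
    · exact (hlmax k (.inr ⟨hc0, h⟩)).not_gt hc.1
    · exact (humin k (.inr ⟨hc0, h⟩)).not_gt hc.2

variable [IsRealClosed R] [IsRealClosed S]

/-- Suppose `a` is a root missed by `K`. The roots of `p'` lie in `K` by induction, so `a` is the
only root of `p` in a bracket with ends from `K`, and `p` changes sign across it. The sign change
transfers to `S` and yields a root `b` there, in the same cut over `K` as `a`. Then `(a, b)` can be
adjoined, against maximality. -/
theorem exists_of_eval_map_eq_zero_aux (h : SignCompatible f g) (hm : IsMaximal f g) {p : K[X]}
    (hp : p ≠ 0) (ih : ∀ q : K[X], q ≠ 0 → q.natDegree < p.natDegree →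
      (∀ x, (q.map f).eval x = 0 → ∃ k, f k = x) ∧ ∀ x, (q.map g).eval x = 0 → ∃ k, g k = x)
    {a : R} (ha : (p.map f).eval a = 0) : ∃ k, f k = a := by
  by_contra! hak
  have : CharZero K := (f.charZero_iff f.injective).2 inferInstance
  have hpos : 0 < p.natDegree := by
    by_contra! h0
    rw [eq_C_of_natDegree_le_zero h0] at ha hp
    simp at ha hp
    exact hp ha
  have hq0 : derivative p ≠ 0 := fun h0 =>
    hpos.ne' (derivative_eq_zero.1 h0)
  have hq := ih _ hq0 (natDegree_derivative_lt hpos.ne')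
  obtain ⟨l, u, hla, hau, hlu⟩ := exists_bracket f hpos hq0 hq.1 ha hak
  have hlu' : ∀ c ∈ Set.Ioo (g l) (g u), ((derivative p).map g).eval c ≠ 0 := by
    intro c hc hc0
    obtain ⟨k, rfl⟩ := hq.2 c hc0
    rw [eval_map_apply, map_eq_zero] at hc0
    exact hlu (f k) ⟨(h.lt_iff _ _).2 hc.1, (h.lt_iff _ _).2 hc.2⟩ (by
      rw [eval_map_apply, hc0, map_zero])
  rw [← derivative_map] at hlu hlu'
  have hneg := IsRealClosed.eval_mul_eval_neg_of_eval_derivative_ne_zero hla hau hlu ha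
  have hneg_iff : ∀ x y, (p.map f).eval (f x) * (p.map f).eval (f y) < 0 ↔
      (p.map g).eval (g x) * (p.map g).eval (g y) < 0 := fun x y => by
    simp only [eval_map_apply, ← map_mul]
    exact h.neg_iff _
  obtain ⟨b, hb, hb0⟩ := IsRealClosed.exists_isRoot_of_eval_mul_eval_neg
    ((h.lt_iff _ _).1 (hla.trans hau)).le ((hneg_iff _ _).1 hneg)
  -- On a subinterval avoiding `a`, `p` has no root; the resulting equality of signs passes to `S`
  -- and locates `b` relative to `g`.
  have hpos_of : ∀ x y, f l ≤ f x → f x ≤ f y → f y ≤ f u → (f y < a ∨ a < f x) →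
      0 < (p.map g).eval (g x) * (p.map g).eval (g y) := by
    intro x y hx hxy hy hor
    have : 0 < (p.map f).eval (f x) * (p.map f).eval (f y) :=
      IsRealClosed.eval_mul_eval_pos hxy fun c hc hc0 => by
        obtain rfl : c = a := IsRealClosed.eq_of_eval_derivative_ne_zero hlu
          ⟨hx.trans hc.1, hc.2.trans hy⟩ ⟨hla.le, hau.le⟩ hc0 ha
        rcases hor with h' | h'
        · exact h'.not_ge hc.2
        · exact h'.not_ge hc.1
    simp only [eval_map_apply, ← map_mul] at this ⊢
    exact (h _).1 this
  have hlt : ∀ k, f k < a → g k < b := by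
    intro k hk
    by_contra! hbk
    have hlk : f l < f k := (h.lt_iff _ _).2 (hb.1.trans_le hbk)
    have hku := hk.trans hau
    have h1 := hpos_of l k le_rfl hlk.le hku.le (.inl hk)
    rcases hbk.eq_or_lt with rfl | hbk
    · simp [hb0] at h1
    · exact h1.not_gt (IsRealClosed.eval_mul_eval_neg_of_eval_derivative_ne_zero hb.1 hbk
        (fun c hc => hlu' c ⟨hc.1, hc.2.trans ((h.lt_iff _ _).1 hku)⟩) hb0)
  have hgt : ∀ k, a < f k → b < g k := by
    intro k hk
    by_contra! hbk
    have hku : f k < f u := (h.lt_iff _ _).2 (hbk.trans_lt hb.2)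
    have hlk := hla.trans hk
    have h1 := hpos_of k u hlk.le hku.le le_rfl (.inr hk)
    rcases hbk.eq_or_lt with rfl | hbk
    · simp [hb0] at h1
    · exact h1.not_gt (IsRealClosed.eval_mul_eval_neg_of_eval_derivative_ne_zero hbk hb.2
        (fun c hc => hlu' c ⟨((h.lt_iff _ _).1 hlk).trans hc.1, hc.2⟩) hb0)
  -- Modulo `p` the polynomial `G` drops in degree, so the roots of its remainder already lie in `K`
  -- and the common cut decides the sign.
  obtain ⟨k, hk, -⟩ := hm a b fun G => by
    rw [coe_eval₂RingHom, coe_eval₂RingHom, ← eval_map, ← eval_map]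
    have hG1 : (G.map f).eval a = ((G % p).map f).eval a := by
      conv_lhs => rw [← EuclideanDomain.div_add_mod G p]
      simp [ha]
    have hG2 : (G.map g).eval b = ((G % p).map g).eval b := by
      conv_lhs => rw [← EuclideanDomain.div_add_mod G p]
      simp [hb0]
    rw [hG1, hG2]
    rcases eq_or_ne (G % p) 0 with h0 | h0
    · simp [h0]
    obtain ⟨ih1, ih2⟩ := ih _ h0 (natDegree_mod_lt G hpos.ne')
    refine h.eval_map_pos_iff h0 ih1 ih2 (fun k _ => ⟨hlt k, fun hk => ?_⟩)
      fun k _ => ⟨hgt k, fun hk => ?_⟩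
    · exact (lt_or_gt_of_ne (hak k)).resolve_right fun h' => (hgt k h').not_gt hk
    · exact (lt_or_gt_of_ne (hak k)).resolve_left fun h' => (hlt k h').not_gt hk
  exact hak k hk

/-- The common domain of a maximal sign compatible pair is relatively algebraically closed. -/
theorem exists_of_eval_map_eq_zero (h : SignCompatible f g) (hm : IsMaximal f g) {p : K[X]}
    (hp : p ≠ 0) : (∀ x, (p.map f).eval x = 0 → ∃ k, f k = x) ∧
      ∀ x, (p.map g).eval x = 0 → ∃ k, g k = x := by
  induction hn : p.natDegree using Nat.strong_induction_on generalizing p with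
  | _ n ih =>
    subst hn
    exact ⟨fun x hx => h.exists_of_eval_map_eq_zero_aux hm hp (fun q hq hd => ih _ hd hq rfl) hx,
      fun x hx => h.symm.exists_of_eval_map_eq_zero_aux hm.symm hp
        (fun q hq hd => (ih _ hd hq rfl).symm) hx⟩

end Field

end SignCompatible

/-! ### Partial isomorphisms as subrings of a product -/

namespace Subring

/-- The two projections of a subring of a product induce the same positive cone. -/
def IsSignCompatible {R S : Type*} [Ring R] [LT R] [Ring S] [LT S] (Γ : Subring (R × S)) : Prop :=
  ∀ x ∈ Γ, 0 < x.1 ↔ 0 < x.2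

/-- The first projection of a subring of a product. -/
abbrev fstHom {R S : Type*} [Ring R] [Ring S] (Γ : Subring (R × S)) : Γ →+* R :=
  (RingHom.fst R S).comp Γ.subtype

/-- The second projection of a subring of a product. -/
abbrev sndHom {R S : Type*} [Ring R] [Ring S] (Γ : Subring (R × S)) : Γ →+* S :=
  (RingHom.snd R S).comp Γ.subtype

theorem IsSignCompatible.mono {R S : Type*} [Ring R] [LT R] [Ring S] [LT S]
    {Γ Δ : Subring (R × S)} (h : Δ.IsSignCompatible) (hle : Γ ≤ Δ) : Γ.IsSignCompatible :=
  fun x hx => h x (hle hx)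

theorem IsSignCompatible.signCompatible {R S : Type*} [Ring R] [LT R] [Ring S] [LT S]
    {Γ : Subring (R × S)} (h : Γ.IsSignCompatible) : SignCompatible Γ.fstHom Γ.sndHom :=
  fun x => h x x.2

theorem IsSignCompatible.exists_maximal {R S : Type*} [Ring R] [LT R] [Ring S] [LT S]
    {Γ : Subring (R × S)} (h : Γ.IsSignCompatible) :
    ∃ M : Subring (R × S), Γ ≤ M ∧ Maximal IsSignCompatible M := by
  refine zorn_le_nonempty₀ {M : Subring (R × S) | M.IsSignCompatible} (fun c hc hchain y hy => ?_)
    Γ h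
  refine ⟨sSup c, fun x hx => ?_, fun z hz => le_sSup hz⟩
  obtain ⟨M, hM, hxM⟩ := (mem_sSup_of_directedOn ⟨y, hy⟩ hchain.directedOn).1 hx
  exact hc hM x hxM

/-- The elements which become members of a subring after clearing denominators. -/
def fractions {R S : Type*} [Field R] [Field S] (Γ : Subring (R × S)) : Subring (R × S) where
  carrier := {z | ∃ y ∈ Γ, y.1 ≠ 0 ∧ z * y ∈ Γ}
  mul_mem' := by
    rintro z w ⟨y, hy, hy0, hz⟩ ⟨y', hy', hy0', hw⟩
    refine ⟨y * y', mul_mem hy hy', mul_ne_zero hy0 hy0', ?_⟩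
    rw [mul_mul_mul_comm]
    exact mul_mem hz hw
  one_mem' := ⟨1, one_mem _, one_ne_zero, by simp [one_mem]⟩
  add_mem' := by
    rintro z w ⟨y, hy, hy0, hz⟩ ⟨y', hy', hy0', hw⟩
    refine ⟨y * y', mul_mem hy hy', mul_ne_zero hy0 hy0', ?_⟩
    have : (z + w) * (y * y') = z * y * y' + w * y' * y := by ring
    rw [this]
    exact add_mem (mul_mem hz hy') (mul_mem hw hy)
  zero_mem' := ⟨1, one_mem _, one_ne_zero, by simp [zero_mem]⟩
  neg_mem' := by
    rintro z ⟨y, hy, hy0, hz⟩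
    exact ⟨y, hy, hy0, by rw [neg_mul]; exact neg_mem hz⟩

/-- The subring of a product generated by a subring and one further element, as the range of
polynomial evaluation. -/
theorem closure_insert_le_range {R S : Type*} [Field R] [Field S] (Γ : Subring (R × S)) (a : R)
    (b : S) :
    closure (insert (a, b) (Γ : Set (R × S))) ≤
      ((eval₂RingHom Γ.fstHom a).prod (eval₂RingHom Γ.sndHom b)).range := by
  rw [closure_le, Set.insert_subset_iff]
  refine ⟨⟨X, by simp⟩, fun x hx => ⟨C ⟨x, hx⟩, by simp⟩⟩

theorem isSignCompatible_closure_insert {R S : Type*} [Field R] [LT R] [Field S] [LT S]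
    {Γ : Subring (R × S)} {a : R} {b : S}
    (h : SignCompatible (eval₂RingHom Γ.fstHom a) (eval₂RingHom Γ.sndHom b)) :
    (closure (insert (a, b) (Γ : Set (R × S)))).IsSignCompatible := by
  intro x hx
  obtain ⟨p, rfl⟩ := closure_insert_le_range Γ a b hx
  exact h p

theorem isMaximal_of_maximal {R S : Type*} [Field R] [LT R] [Field S] [LT S]
    {Γ : Subring (R × S)} (hΓ : Maximal IsSignCompatible Γ) :
    SignCompatible.IsMaximal Γ.fstHom Γ.sndHom := fun a b h =>
  ⟨⟨(a, b), hΓ.le_of_ge (isSignCompatible_closure_insert h)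
    ((Set.subset_insert _ _).trans subset_closure) (subset_closure (Set.mem_insert _ _))⟩,
    rfl, rfl⟩

variable {R S : Type*} [Field R] [LinearOrder R] [IsStrictOrderedRing R] [Field S]
  [LinearOrder S] [IsStrictOrderedRing S] {Γ : Subring (R × S)}

theorem isSignCompatible_bot : (⊥ : Subring (R × S)).IsSignCompatible := by
  rintro _ hx
  obtain ⟨n, rfl⟩ := mem_bot.1 hx
  simp

namespace IsSignCompatible

theorem fst_lt_fst_iff (h : Γ.IsSignCompatible) {x y : R × S} (hx : x ∈ Γ) (hy : y ∈ Γ) :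
    x.1 < y.1 ↔ x.2 < y.2 :=
  h.signCompatible.lt_iff ⟨x, hx⟩ ⟨y, hy⟩

theorem fst_eq_fst_iff (h : Γ.IsSignCompatible) {x y : R × S} (hx : x ∈ Γ) (hy : y ∈ Γ) :
    x.1 = y.1 ↔ x.2 = y.2 :=
  h.signCompatible.eq_iff ⟨x, hx⟩ ⟨y, hy⟩

theorem fst_eq_zero_iff (h : Γ.IsSignCompatible) {x : R × S} (hx : x ∈ Γ) : x.1 = 0 ↔ x.2 = 0 :=
  h.signCompatible.eq_zero_iff ⟨x, hx⟩

/-- In each coordinate `z` has the sign of `z * y * y`, which lies in `Γ`. -/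
theorem isSignCompatible_fractions (h : Γ.IsSignCompatible) : Γ.fractions.IsSignCompatible := by
  rintro z ⟨y, hy, hy0, hz⟩
  have hy0' : y.2 ≠ 0 := fun h0 => hy0 ((h.fst_eq_zero_iff hy).2 h0)
  have := h _ (mul_mem hz hy)
  simp only [Prod.fst_mul, Prod.snd_mul, mul_assoc] at this
  rwa [mul_pos_iff_of_pos_right (mul_self_pos.2 hy0),
    mul_pos_iff_of_pos_right (mul_self_pos.2 hy0')] at this

end IsSignCompatible

theorem isField_of_maximal (hΓ : Maximal IsSignCompatible Γ) : IsField Γ where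
  exists_pair_ne := ⟨0, 1, zero_ne_one⟩
  mul_comm := mul_comm
  mul_inv_cancel := by
    rintro ⟨y, hy⟩ hne
    have hy1 : y.1 ≠ 0 := fun h0 => hne <| Subtype.ext <|
      Prod.ext h0 ((hΓ.prop.fst_eq_zero_iff hy).1 h0)
    have hy2 : y.2 ≠ 0 := fun h0 => hy1 ((hΓ.prop.fst_eq_zero_iff hy).2 h0)
    have hinv : ((y.1⁻¹, y.2⁻¹) : R × S) * y = 1 := by
      ext <;> simp [hy1, hy2]
    have hle := hΓ.le_of_ge hΓ.prop.isSignCompatible_fractions fun z hz =>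
      ⟨1, one_mem _, one_ne_zero, by rwa [mul_one]⟩
    refine ⟨⟨(y.1⁻¹, y.2⁻¹), hle ⟨y, hy, hy1, ?_⟩⟩, Subtype.ext ?_⟩
    · rw [hinv]; exact one_mem _
    · rw [mul_comm]; exact hinv

end Subring

/-! ### Adjoining one element, and transfinite recursion -/

theorem Subring.cardinalMk_isAlgebraic_le_max {S : Type u} [Field S] (A : Subring S) :
    #{d : S // IsAlgebraic A d} ≤ max #A ℵ₀ := by
  have : Module.IsTorsionFree A S := .of_smul_eq_zero fun a x h => by
    simpa [Subring.smul_def] using h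
  exact Algebraic.cardinalMk_le_max A S

/-- The maximal extension `M` may be too large for the `η_α` property. But only polynomials over `Γ`
must keep their signs, and their roots, which all come from `M`, have second coordinates algebraic
over the projection of `Γ`. So `b` need only fill the cut among those. -/
theorem IsEtaSet.exists_isSignCompatible_closure_insert {α : Ordinal.{u}} (hα : 0 < α)
    {R S : Type u} [Field R] [LinearOrder R] [IsStrictOrderedRing R] [IsRealClosed R] [Field S]
    [LinearOrder S] [IsStrictOrderedRing S] [IsRealClosed S] (hS : IsEtaSet α S)
    {Γ : Subring (R × S)} (hΓ : Γ.IsSignCompatible) (hcard : #Γ < ℵ_ α) (a : R) :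
    ∃ b, (Subring.closure (insert (a, b) (Γ : Set (R × S)))).IsSignCompatible := by
  obtain ⟨M, hΓM, hM⟩ := hΓ.exists_maximal
  by_cases hex : ∃ b, (a, b) ∈ M
  · obtain ⟨b, hb⟩ := hex
    exact ⟨b, hM.prop.mono ((Subring.closure_le).2 (Set.insert_subset hb hΓM))⟩
  push Not at hex
  let T : Set S := {d | IsAlgebraic Γ.sndHom.range d}
  have hT : #T < ℵ_ α := by
    refine (Subring.cardinalMk_isAlgebraic_le_max Γ.sndHom.range).trans_lt (max_lt ?_ ?_)
    · exact (Cardinal.mk_le_of_surjective Γ.sndHom.rangeRestrict_surjective).trans_lt hcard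
    · rw [← Cardinal.aleph_zero]; exact Cardinal.aleph_lt_aleph.2 hα
  obtain ⟨b, hb1, hb2⟩ := hS {d | d ∈ T ∧ ∃ c, (c, d) ∈ M ∧ c < a}
    {d | d ∈ T ∧ ∃ c, (c, d) ∈ M ∧ a < c}
    ((Cardinal.mk_le_mk_of_subset fun _ h => h.1).trans_lt hT)
    ((Cardinal.mk_le_mk_of_subset fun _ h => h.1).trans_lt hT) (by
      rintro d ⟨-, c, hc, hca⟩ d' ⟨-, c', hc', hac⟩
      exact (hM.prop.fst_lt_fst_iff hc hc').1 (hca.trans hac))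
  refine ⟨b, Subring.isSignCompatible_closure_insert fun p => ?_⟩
  let := (Subring.isField_of_maximal hM).toField
  have hcompat := hM.prop.signCompatible
  rcases eq_or_ne p 0 with rfl | hp
  · simp
  let j : Γ →+* M := Subring.inclusion hΓM
  have hj : Function.Injective j := Subring.inclusion_injective hΓM
  have hq : p.map j ≠ 0 := (Polynomial.map_ne_zero_iff hj).2 hp
  have hclosed := hcompat.exists_of_eval_map_eq_zero (Subring.isMaximal_of_maximal hM) hq
  have e1 : eval₂RingHom Γ.fstHom a p = ((p.map j).map M.fstHom).eval a := by
    rw [Polynomial.map_map, eval_map]; rfl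
  have e2 : eval₂RingHom Γ.sndHom b p = ((p.map j).map M.sndHom).eval b := by
    rw [Polynomial.map_map, eval_map]; rfl
  rw [e1, e2]
  have hne : ∀ k : M, M.fstHom k ≠ a := fun k hk => hex k.1.2 (by rw [← hk]; exact k.2)
  have halg : ∀ k : M, (p.map j).eval k = 0 → M.sndHom k ∈ T := by
    intro k hk
    refine ⟨p.map Γ.sndHom.rangeRestrict, (Polynomial.map_ne_zero_iff ?_).2 hp, ?_⟩
    · intro x y h
      have hxy : x.1.2 = y.1.2 := congrArg Subtype.val h
      exact Subtype.ext (Prod.ext ((hΓ.fst_eq_fst_iff x.2 y.2).2 hxy) hxy)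
    · have h0 := congrArg M.sndHom hk
      rw [← eval_map_apply, map_zero, Polynomial.map_map, eval_map] at h0
      rw [aeval_def, eval₂_map]
      exact h0
  have hlt : ∀ k : M, (p.map j).eval k = 0 → M.fstHom k < a → M.sndHom k < b := fun k hk hka =>
    hb1 _ ⟨halg k hk, _, k.2, hka⟩
  have hgt : ∀ k : M, (p.map j).eval k = 0 → a < M.fstHom k → b < M.sndHom k := fun k hk hka =>
    hb2 _ ⟨halg k hk, _, k.2, hka⟩
  exact hcompat.eval_map_pos_iff hq hclosed.1 hclosed.2
    (fun k hk => ⟨hlt k hk, fun h =>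
      (lt_or_gt_of_ne (hne k)).resolve_right fun h' => (hgt k hk h').not_gt h⟩)
    fun k hk => ⟨hgt k hk, fun h =>
      (lt_or_gt_of_ne (hne k)).resolve_left fun h' => (hlt k hk h').not_gt h⟩

theorem Subring.cardinalMk_closure_le_max {R : Type u} [Ring R] (s : Set R) :
    #(Subring.closure s) ≤ max #s ℵ₀ := by
  have h := Algebra.lift_cardinalMk_adjoin_le ℤ s
  rw [Algebra.adjoin_int] at h
  simp only [Cardinal.lift_id', Cardinal.mk_int, Cardinal.lift_aleph0] at h
  exact h.trans (max_le (max_le (le_max_right _ _) (le_max_left _ _)) (le_max_right _ _))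

theorem Subring.isSignCompatible_closure_image {ι R S : Type*} [LinearOrder ι] [Field R]
    [LinearOrder R] [IsStrictOrderedRing R] [Field S] [LinearOrder S] [IsStrictOrderedRing S]
    {φ : ι → R × S} {J : Set ι}
    (h : ∀ j ∈ J, (closure (φ '' Set.Iic j)).IsSignCompatible) :
    (closure (φ '' J)).IsSignCompatible := by
  rcases J.eq_empty_or_nonempty with rfl | hJ
  · rw [Set.image_empty, closure_empty]
    exact isSignCompatible_bot
  have : Nonempty J := hJ.to_subtype
  have hmono : Monotone fun j : J => closure (φ '' Set.Iic (j : ι)) := fun i j hij =>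
    closure_mono (Set.image_mono (Set.Iic_subset_Iic.2 hij))
  have hle : closure (φ '' J) ≤ ⨆ j : J, closure (φ '' Set.Iic (j : ι)) := by
    rw [closure_le]
    rintro _ ⟨j, hj, rfl⟩
    exact (le_iSup (fun j : J => closure (φ '' Set.Iic (j : ι))) ⟨j, hj⟩)
      (subset_closure (Set.mem_image_of_mem _ Set.self_mem_Iic))
  intro x hx
  obtain ⟨j, hj⟩ := (mem_iSup_of_directed hmono.directed_le).1 (hle hx)
  exact h j j.2 x hj

theorem IsEtaSet.exists_isSignCompatible_closure_range {α : Ordinal.{u}} (hα : 0 < α)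
    {ι R S : Type u} [LinearOrder ι] [WellFoundedLT ι] [Field R] [LinearOrder R]
    [IsStrictOrderedRing R] [IsRealClosed R] [Field S] [LinearOrder S] [IsStrictOrderedRing S]
    [IsRealClosed S] (hS : IsEtaSet α S) (hι : ∀ i : ι, #(Set.Iio i) < ℵ_ α) (e : ι → R) :
    ∃ b : ι → S, (Subring.closure (Set.range fun i => (e i, b i))).IsSignCompatible := by
  classical
  let P (i : ι) (s : Set (R × S)) (y : S) : Prop :=
    (Subring.closure (insert (e i, y) s)).IsSignCompatible
  -- The default `0` is never taken: `key` shows by induction that a suitable value exists at every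
  -- index.
  let b : ι → S := wellFounded_lt.fix fun i rec =>
    if h : ∃ y, P i (Set.range fun j : Set.Iio i => (e j, rec j j.2)) y then h.choose else 0
  let φ : ι → R × S := fun i => (e i, b i)
  have hb : ∀ i, b i = if h : ∃ y, P i (φ '' Set.Iio i) y then h.choose else 0 := by
    intro i
    rw [Set.image_eq_range]
    exact wellFounded_lt.fix_eq _ i
  have key : ∀ i, (Subring.closure (φ '' Set.Iic i)).IsSignCompatible := by
    intro i
    induction i using WellFoundedLT.induction with
    | _ i ih =>
      have hΓ : (Subring.closure (φ '' Set.Iio i)).IsSignCompatible :=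
        Subring.isSignCompatible_closure_image ih
      have hcard : #(Subring.closure (φ '' Set.Iio i)) < ℵ_ α := by
        refine (Subring.cardinalMk_closure_le_max _).trans_lt (max_lt ?_ ?_)
        · exact Cardinal.mk_image_le.trans_lt (hι i)
        · rw [← Cardinal.aleph_zero]; exact Cardinal.aleph_lt_aleph.2 hα
      have hex : ∃ y, P i (φ '' Set.Iio i) y := by
        obtain ⟨y, hy⟩ := hS.exists_isSignCompatible_closure_insert hα hΓ hcard (e i)
        exact ⟨y, hy.mono (Subring.closure_mono (Set.insert_subset_insert Subring.subset_closure))⟩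
      have hbi : P i (φ '' Set.Iio i) (b i) := by
        rw [hb, dif_pos hex]
        exact hex.choose_spec
      rw [← Set.Iio_insert, Set.image_insert_eq]
      exact hbi
  refine ⟨b, ?_⟩
  rw [← Set.image_univ]
  exact Subring.isSignCompatible_closure_image fun i _ => key i

/-! ### The ultrapower and the bounded self-embedding -/

/-- An ultrapower of a real closed field is real closed. -/
theorem Filter.Germ.isRealClosed {ι F : Type*} [Field F] [LinearOrder F] [IsStrictOrderedRing F]
    [IsRealClosed F] (U : Ultrafilter ι) : IsRealClosed (Filter.Germ (U : Filter ι) F) := by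
  refine IsRealClosed.of_linearOrderedField (fun {x} hx => ?_) fun {p} hp => ?_
  · induction x using Filter.Germ.inductionOn with
    | _ f =>
    have hf : ∀ᶠ i in (U : Filter ι), 0 ≤ f i := Filter.Germ.coe_nonneg.1 hx
    have : ∀ i, ∃ y, 0 ≤ f i → f i = y * y := fun i => by
      by_cases h : 0 ≤ f i
      · obtain ⟨y, hy⟩ := IsSquare.of_nonneg h
        exact ⟨y, fun _ => hy⟩
      · exact ⟨0, fun h' => absurd h' h⟩
    choose g hg using this
    exact ⟨(g : Filter.Germ (U : Filter ι) F), by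
      rw [← Filter.Germ.coe_mul]
      exact Filter.Germ.coe_eq.2 (hf.mono hg)⟩
  · have hrep : ∀ n, ∃ c : ι → F, (c : Filter.Germ (U : Filter ι) F) = p.coeff n := fun n =>
      (p.coeff n).inductionOn fun c => ⟨c, rfl⟩
    choose c hc using hrep
    -- Coefficientwise representatives of `p`; for `U`-almost all `i` the top coefficient survives,
    -- so `P i` has the same odd degree.
    let P (i : ι) : F[X] := ∑ n ∈ Finset.range (p.natDegree + 1), C (c n i) * X ^ n
    have hcoeff : ∀ i, (P i).coeff p.natDegree = c p.natDegree i := fun i => by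
      simp [P, coeff_C_mul, coeff_X_pow]
    have hle : ∀ i, (P i).natDegree ≤ p.natDegree := fun i =>
      natDegree_sum_le_of_forall_le _ _ fun n hn =>
        (natDegree_C_mul_X_pow_le _ _).trans (Nat.lt_succ_iff.1 (Finset.mem_range.1 hn))
    have hne : ∀ᶠ i in (U : Filter ι), c p.natDegree i ≠ 0 := by
      rw [Ultrafilter.eventually_not]
      intro h0
      have : p.leadingCoeff = 0 := by
        rw [leadingCoeff, ← hc]
        exact Filter.Germ.coe_eq.2 h0
      rw [leadingCoeff_eq_zero] at this
      simp [this] at hp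
    have : ∀ i, ∃ x, c p.natDegree i ≠ 0 → (P i).eval x = 0 := fun i => by
      by_cases h : c p.natDegree i = 0
      · exact ⟨0, fun h' => absurd h h'⟩
      · have hdeg : (P i).natDegree = p.natDegree :=
          natDegree_eq_of_le_of_coeff_ne_zero (hle i) (by rwa [hcoeff])
        obtain ⟨x, hx⟩ := IsRealClosed.exists_isRoot_of_odd_natDegree (hdeg ▸ hp)
        exact ⟨x, fun _ => hx⟩
    choose x hx using this
    refine ⟨(x : Filter.Germ (U : Filter ι) F), ?_⟩
    have heval : p.eval (x : Filter.Germ (U : Filter ι) F) =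
        ((fun i => (P i).eval (x i) : ι → F) : Filter.Germ (U : Filter ι) F) := by
      have : (fun i => (P i).eval (x i)) =
          ∑ n ∈ Finset.range (p.natDegree + 1), c n * x ^ n := by
        ext i
        simp [P, eval_finsetSum]
      rw [this, eval_eq_sum_range]
      simp only [← hc]
      exact (map_sum (Filter.Germ.coeRingHom (U : Filter ι)) (fun n => c n * x ^ n) _).symm
    rw [IsRoot, heval]
    exact Filter.Germ.coe_eq.2 (hne.mono hx)

theorem IsRealClosedEtaField.exists_ringHom_lt {α : Ordinal.{u}} (hα : 0 < α) {F : Type u}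
    [Field F] [LinearOrder F] [IsStrictOrderedRing F] (hF : IsRealClosedEtaField α F)
    (hcard : #F = ℵ_ α) : ∃ φ : F →+* F, StrictMono φ ∧ ∃ c, ∀ x, φ x < c := by
  have := hF.isRealClosed
  let U : Ultrafilter F := Ultrafilter.of Filter.atTop
  let E := Filter.Germ (U : Filter F) F
  have : IsRealClosed E := Filter.Germ.isRealClosed U
  have : Infinite F := CharZero.infinite F
  -- The initial ordinal makes every proper initial segment smaller than `ℵ_α`; `Option F` supplies
  -- one extra index, `none`, for `t`.
  let ι := (#F).ord.ToType
  have hι : #ι = #(Option F) := by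
    rw [Cardinal.mk_option, Cardinal.mk_ord_toType]
    exact (Cardinal.add_one_eq (Cardinal.aleph0_le_mk F)).symm
  obtain ⟨σ⟩ := Cardinal.eq.1 hι
  let k : F →+* E := (Filter.Germ.coeRingHom (U : Filter F)).comp (Pi.constRingHom F F)
  have hk : StrictMono k := fun x y hxy => Filter.Germ.const_lt hxy
  let t : E := ((id : F → F) : Filter.Germ (U : Filter F) F)
  have ht : ∀ x, k x < t := fun x => Filter.Germ.coe_lt.2 <|
    Ultrafilter.of_le _ (Filter.eventually_gt_atTop x)
  obtain ⟨b, hb⟩ := hF.isEtaSet.exists_isSignCompatible_closure_range hα (ι := ι) (R := E)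
    (fun i => (Cardinal.mk_Iio_lt i (by simp [ι])).trans_eq
      ((Cardinal.mk_ord_toType _).trans hcard)) (fun i => (σ i).elim t k)
  set Γ := Subring.closure (Set.range fun i => ((σ i).elim t k, b i))
  let f (x : F) : F := b (σ.symm (some x))
  have hf : ∀ x, (k x, f x) ∈ Γ := fun x => by
    have := Subring.subset_closure (s := Set.range fun i => ((σ i).elim t k, b i))
      ⟨σ.symm (some x), rfl⟩
    simpa using this
  have hc : (t, b (σ.symm none)) ∈ Γ := by
    have := Subring.subset_closure (s := Set.range fun i => ((σ i).elim t k, b i))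
      ⟨σ.symm none, rfl⟩
    simpa using this
  refine ⟨{
    toFun := f
    map_one' := (hb.fst_eq_fst_iff (hf 1) (one_mem _)).1 (map_one k)
    map_mul' := fun x y => (hb.fst_eq_fst_iff (hf _) (mul_mem (hf x) (hf y))).1 (map_mul k x y)
    map_zero' := (hb.fst_eq_fst_iff (hf 0) (zero_mem _)).1 (map_zero k)
    map_add' := fun x y => (hb.fst_eq_fst_iff (hf _) (add_mem (hf x) (hf y))).1 (map_add k x y) },
    fun x y hxy => (hb.fst_lt_fst_iff (hf x) (hf y)).1 (hk hxy),
    b (σ.symm none), fun x => (hb.fst_lt_fst_iff (hf x) hc).1 (ht x)⟩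

theorem mainTheorem5 (α : Ordinal.{u}) (hα : 0 < α)
    (F : Type u) [Field F] [LinearOrder F] [IsStrictOrderedRing F]
    (hF : IsRealClosedEtaField α F) (hcard : #F = ℵ_ α) :
    ∃ K : Subfield F, K ≠ ⊤ ∧ Nonempty (K ≃+*o F) := by
  obtain ⟨φ, hφ, c, hc⟩ := hF.exists_ringHom_lt hα hcard
  refine ⟨φ.fieldRange, fun htop => ?_, ?_⟩
  · obtain ⟨x, hx⟩ : c ∈ φ.fieldRange := htop ▸ Subfield.mem_top c
    exact (hc x).ne hx
  · let e : F ≃+* φ.fieldRange := RingEquiv.ofBijective φ.rangeRestrictField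
      φ.rangeRestrictField_bijective
    let e' : F ≃+*o φ.fieldRange := { e with map_le_map_iff' := fun {a b} => hφ.le_iff_le }
    exact ⟨e'.symm⟩
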